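/- Let $d\ge 1$, let $B(x,r)=\{y\in\mathbb{R}^d:\|x-y\|\le r\}$ be the closed Euclidean ball, and for an integer $k>0$ call a Borel probability measure $p$ on $\mathbb{R}^d$ *$k$-regular* if for every $\epsilon>0$ there is a constant $p_\epsilon\in(0,1]$ such that for all $x\in\operatorname{supp}(p)$ and all $0<s<r$ with $p(B(x,r))\le p_\epsilon$, $$\Bigl(1+\tfrac{\epsilon}{3}\Bigr)^{-1}\frac{r^k}{s^k}\le\frac{p(B(x,r))}{p(B(x,s))}\le\Bigl(1+\tfrac{\epsilon}{3}\Bigr)\frac{r^k}{s^k}.$$ For a sample $S=(x_1,\dots,x_n)$ in $\mathbb{R}^d$ write $|S\cap B(x,r)|$ for the number of indices $i$ with $x_i\in B(x,r)$. Given $k$, $\epsilon,\delta$ and a constant $c>0$, put $$b=\left\lceil c\,\frac{d\ln (n/\delta)}{\min(\epsilon,1)^2}\right\rceil,\qquad r_*(x)=\inf\{s>0:\ |S\cap B(x,s)|\ge b\},$$ (with $\inf\emptyset=0$) and $$\mathrm{Est}(x,r,S)=\begin{cases}\dfrac{b\,r^k}{n\,r_*(x)^k}, & r<r_*(x),\\[2mm]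 \dfrac{|S\cap B(x,r)|}{n}, & r\ge r_*(x).\end{cases}$$ **Proposition.** There is an absolute constant $c_0>0$ such that for every $c\ge c_0$ there is a constant $C>0$, depending only on $c$, with the following property. Let $d\ge1$, let $p$ be a $k$-regular distribution on $\mathbb{R}^d$, let $\epsilon>0$, $0<\delta<1$, let $p_\epsilon\in(0,1]$ be any constant as in the definition of $k$-regularity for this $\epsilon$, and let $$n\ \ge\ C\,\frac{d\,\ln\frac{2d}{\delta\min(\epsilon,1)\,p_\epsilon}}{\min(\epsilon,1)^2\,p_\epsilon}.$$ Then with probability at least $1-\delta$ over $S\sim p^n$ (that is, the complementary event has outer measure at most $\delta$), the estimate $$\Bigl(1+\tfrac{\epsilon}{2}\Bigr)^{-1}\le\frac{\mathrm{Est}(x,r,S)}{p(B(x,r))}\le 1+\tfrac{\epsilon}{2}$$ holds simultaneously 1. for all $x\in\operatorname{supp}(p)$ and all $r>0$, where $x$ is such that $|S\cap B(x,r_*(x))|=b$ or the sphere of radius $r_*(x)$ around $x$ has $p$-measure zero; and 2. for all $x\in\mathbb{R}^d$ and all $r>0$ with $r\ge r_*(x)$. In particular, if spheres of positive radius centred in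 $\operatorname{supp}(p)$ have $p$-measure zero, the estimate holds simultaneously for all $x\in\operatorname{supp}(p)$ and all $r>0$. -/

import Mathlib

open MeasureTheory

/-- `pε` is a regularity constant of `p` for the exponent `k` and the tolerance `ε`: around every
point of the support of `p`, the masses of closed balls of mass at most `pε` follow the power law
with exponent `k` up to the factor `1 + ε / 3`. -/
def IsRegularityConstant {d : ℕ} (p : Measure (EuclideanSpace ℝ (Fin d))) (k : ℕ)
    (ε pε : ℝ) : Prop :=
  0 < pε ∧ pε ≤ 1 ∧
    ∀ x ∈ p.support, ∀ s r : ℝ, 0 < s → s < r → p.real (Metric.closedBall x r) ≤ pε →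
      (1 + ε / 3)⁻¹ * (r ^ k / s ^ k) ≤
          p.real (Metric.closedBall x r) / p.real (Metric.closedBall x s) ∧
        p.real (Metric.closedBall x r) / p.real (Metric.closedBall x s) ≤
          (1 + ε / 3) * (r ^ k / s ^ k)

/-- `k`-regular distributions on `ℝ^d`. -/
def IsKRegular {d : ℕ} (p : Measure (EuclideanSpace ℝ (Fin d))) (k : ℕ) : Prop :=
  0 < k ∧ ∀ ε : ℝ, 0 < ε → ∃ pε : ℝ, IsRegularityConstant p k ε pε

/-- `|S ∩ B(x, r)|`: the number of sample points, counted with multiplicity, in the closed ball. -/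
noncomputable def ballCount {d n : ℕ} (S : Fin n → EuclideanSpace ℝ (Fin d))
    (x : EuclideanSpace ℝ (Fin d)) (r : ℝ) : ℕ :=
  Nat.card {i : Fin n // S i ∈ Metric.closedBall x r}

/-- The radius `r_*`: the smallest radius at which the ball around `x` holds `b` sample points.
If some ball around `x` of positive radius holds exactly `b` points, this is the infimum of
`{s > 0 : |S ∩ B(x, s)| = b}`, and it is the minimum of that set unless it is `0`. -/
noncomputable def rStar {d n : ℕ} (b : ℕ) (S : Fin n → EuclideanSpace ℝ (Fin d))
    (x : EuclideanSpace ℝ (Fin d)) : ℝ :=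
  sInf {s : ℝ | 0 < s ∧ b ≤ ballCount S x s}

open Classical in
/-- The estimator `Est(x, r, S)` with exponent `k` and count threshold `b`. -/
noncomputable def Est {d n : ℕ} (k b : ℕ) (x : EuclideanSpace ℝ (Fin d)) (r : ℝ)
    (S : Fin n → EuclideanSpace ℝ (Fin d)) : ℝ :=
  if r < rStar b S x then (b : ℝ) * r ^ k / ((n : ℝ) * rStar b S x ^ k)
  else (ballCount S x r : ℝ) / (n : ℝ)

/-- The threshold `b = O(d ln(n/δ) / ε²)` with constant `c`, rounded up to an integer
(a tolerance `ε > 1` is replaced by `1`). -/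
noncomputable def countThreshold (c : ℝ) (d n : ℕ) (ε δ : ℝ) : ℕ :=
  ⌈c * ((d : ℝ) * Real.log ((n : ℝ) / δ) / (min ε 1) ^ 2)⌉₊

/-- `Est(x, r, S)` is within a factor `1 + ε / 2` of `p(B(x, r))`. The lower bound on the
quotient forces `p(B(x, r)) > 0`. -/
def IsAccurate {d n : ℕ} (p : Measure (EuclideanSpace ℝ (Fin d))) (k b : ℕ) (ε : ℝ)
    (x : EuclideanSpace ℝ (Fin d)) (r : ℝ) (S : Fin n → EuclideanSpace ℝ (Fin d)) : Prop :=
  (1 + ε / 2)⁻¹ ≤ Est k b x r S / p.real (Metric.closedBall x r) ∧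
    Est k b x r S / p.real (Metric.closedBall x r) ≤ 1 + ε / 2

/-- The event that the estimator is accurate at all points of the support and all radii at once
(where `r_*` is attained with exactly `b` points, or the sphere of radius `r_*` is `p`-null), and
at all centres of the space for all radii at which the estimator counts. -/
def estAccurateEvent {d : ℕ} (p : Measure (EuclideanSpace ℝ (Fin d))) (k b n : ℕ) (ε : ℝ) :
    Set (Fin n → EuclideanSpace ℝ (Fin d)) :=
  {S | (∀ x ∈ p.support, ∀ r : ℝ, 0 < r →
          (ballCount S x (rStar b S x) = b ∨ p (Metric.sphere x (rStar b S x)) = 0) →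
            IsAccurate p k b ε x r S) ∧
       (∀ x : EuclideanSpace ℝ (Fin d), ∀ r : ℝ, 0 < r → rStar b S x ≤ r →
            IsAccurate p k b ε x r S)}

/-! Outside one event of small probability, every closed ball has sample count and mass agreeing up
to a factor `1 + η`, as far as the threshold `b` can detect (`measure_ballDeviationEvent_le`). The
rest is deterministic. If `r ≥ rStar`, the ball holds at least `b` points and its count is accurate.
If `r < rStar`, the ball of radius `rStar` has mass about `b / n`, hence at most `pε`, and the power
law carries this mass down to radius `r`.

The uniform bound is a Vapnik-Chervonenkis argument. A ball that deviates on the sample differs in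
count from an independent ghost sample with probability at least 1/2. Swapping paired points at
random preserves the joint law. With the `2n` points fixed, only polynomially many ball traces
occur, and Hoeffding's inequality bounds each. Since the variance proxy is the total count itself,
the bound is relative, and `b` of order `d log (n / δ) / ε²` suffices. -/

/-! ### Traces of balls on finite point sets -/

open Finset in
/-- The number of traces of closed balls on a finite family of points is polynomial. -/
theorem card_closedBall_traces_le {d : ℕ} {α : Type*} [Fintype α] [DecidableEq α]
    (z : α → EuclideanSpace ℝ (Fin d)) (𝒜 : Finset (Finset α))
    (h𝒜 : ∀ t ∈ 𝒜, ∃ x r, 0 < r ∧ ∀ j, j ∈ t ↔ z j ∈ Metric.closedBall x r) :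
    #𝒜 ≤ (Fintype.card α + 1) ^ (d + 2) := by
  have hdim : 𝒜.vcDim ≤ d + 2 := by
    refine Finset.sup_le fun s hs => ?_
    rw [mem_shatterer] at hs
    by_contra! hcard
    -- Lifting to a space of dimension `d + 2` makes ball membership the sign of a linear
    -- functional, so more than `d + 2` points are linearly dependent there.
    let v : α → ℝ × EuclideanSpace ℝ (Fin d) × ℝ := fun j => (1, z j, ‖z j‖ ^ 2)
    have hdep : ¬ LinearIndependent ℝ (fun j : s => v j) := fun h => by
      have := h.fintype_card_le_finrank
      simp at this
      omega
    obtain ⟨g, hg, j₀, hj₀⟩ := Fintype.not_linearIndependent_iff.1 hdep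
    -- By shattering, some ball cuts out exactly `{g < 0}`. Its functional `f` is nonpositive there
    -- and positive elsewhere, so every `g j * f j` is nonnegative; they sum to zero, which rules
    -- out `g j > 0`. Applied to `g` and `-g`, this kills the dependence.
    have key : ∀ g : s → ℝ, ∑ j, g j • v j = 0 → ∀ j, g j ≤ 0 := by
      intro g hg
      obtain ⟨u, hu, hut⟩ := hs (t := (univ.filter fun j : s => g j < 0).map
        (Function.Embedding.subtype _)) (by
          intro j hj
          obtain ⟨k, -, rfl⟩ := mem_map.1 hj
          exact k.2)
      obtain ⟨x, r, hr, hxr⟩ := h𝒜 u hu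
      have hmem : ∀ j : s, z j ∈ Metric.closedBall x r ↔ g j < 0 := by
        intro j
        rw [← hxr]
        have := congrArg ((j : α) ∈ ·) hut
        simpa using this
      let f : α → ℝ := fun j => ‖z j‖ ^ 2 - 2 * inner ℝ x (z j) + (‖x‖ ^ 2 - r ^ 2)
      have hf : ∀ j, f j = dist (z j) x ^ 2 - r ^ 2 := by
        intro j
        rw [dist_eq_norm, norm_sub_sq_real, real_inner_comm]
        simp only [f]; ring
      have h1 := congrArg Prod.fst hg
      have h2 := congrArg (fun w => w.2.1) hg
      have h3 := congrArg (fun w => w.2.2) hg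
      simp only [v, Prod.fst_sum, Prod.snd_sum, Prod.smul_mk, Prod.fst_zero, Prod.snd_zero,
        smul_eq_mul, mul_one] at h1 h2 h3
      have h2' := congrArg (inner ℝ x) h2
      simp only [inner_sum, inner_smul_right, inner_zero_right] at h2'
      have hsum : ∑ j : s, g j * f j = 0 := by
        have : ∀ j : s, g j * f j = g j * ‖z j‖ ^ 2 - 2 * (g j * inner ℝ x (z j))
            + (‖x‖ ^ 2 - r ^ 2) * g j := fun j => by simp only [f]; ring
        simp_rw [this, sum_add_distrib, sum_sub_distrib, ← mul_sum, h1, h2', h3]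
        simp
      have hsign : ∀ j : s, 0 ≤ g j * f j ∧ (0 < g j → 0 < g j * f j) := by
        intro j
        have hd : 0 ≤ dist (z j) x := dist_nonneg
        by_cases hj : g j < 0
        · have := (hmem j).2 hj
          rw [Metric.mem_closedBall] at this
          refine ⟨mul_nonneg_of_nonpos_of_nonpos hj.le ?_, fun h => absurd h hj.not_gt⟩
          rw [hf]; nlinarith
        · have := mt (hmem j).1 hj
          rw [Metric.mem_closedBall, not_le] at this
          have hpos : 0 < f j := by rw [hf]; nlinarith
          exact ⟨mul_nonneg (not_lt.1 hj) hpos.le, fun h => mul_pos h hpos⟩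
      intro j
      by_contra! hj
      have := (hsign j).2 hj
      rw [(sum_eq_zero_iff_of_nonneg fun j _ => (hsign j).1).1 hsum j (mem_univ j)] at this
      exact this.false
    have hneg := key (fun j => -g j) (by simpa [sum_neg_distrib] using hg) j₀
    exact hj₀ (le_antisymm (key g hg j₀) (by linarith))
  calc #𝒜 ≤ #𝒜.shatterer := card_le_card_shatterer 𝒜
    _ ≤ ∑ k ∈ Iic 𝒜.vcDim, (Fintype.card α).choose k := card_shatterer_le_sum_vcDim
    _ ≤ ∑ k ∈ range (d + 2 + 1), (Fintype.card α).choose k := by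
      refine sum_le_sum_of_subset fun k hk => ?_
      simp only [mem_Iic, mem_range] at hk ⊢
      omega
    _ ≤ ∑ k ∈ range (d + 2 + 1), Fintype.card α ^ k * 1 ^ (d + 2 - k) * (d + 2).choose k := by
      refine sum_le_sum fun k hk => ?_
      rw [one_pow, mul_one]
      have h1 : 0 < (d + 2).choose k := Nat.choose_pos (by simp at hk; omega)
      exact (Nat.choose_le_pow _ _).trans (Nat.le_mul_of_pos_right _ h1)
    _ = (Fintype.card α + 1) ^ (d + 2) := by rw [add_pow]; simp

/-- A closed ball has the same trace on a finite family of points as some slightly larger balls. -/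
theorem exists_pos_closedBall_trace {X α : Type*} [PseudoMetricSpace X] [Finite α] (z : α → X)
    (x : X) (r : ℝ) :
    ∃ ρ > 0, ∀ y s, dist x y + r ≤ s → s + dist x y ≤ r + ρ → ∀ j,
      (z j ∈ Metric.closedBall y s ↔ z j ∈ Metric.closedBall x r) := by
  cases nonempty_fintype α
  -- Finitely many points outside a closed ball keep a common positive gap from it.
  have hρ : ∃ ρ > 0, ∀ j, r < dist (z j) x → r + ρ < dist (z j) x := by
    have : ∀ j, ∀ᶠ ρ in nhdsWithin (0 : ℝ) (Set.Ioi 0), r < dist (z j) x → r + ρ < dist (z j) x := by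
      intro j
      by_cases hj : r < dist (z j) x
      · have : ∀ᶠ ρ in nhds (0 : ℝ), ρ < dist (z j) x - r := eventually_lt_nhds (by linarith)
        filter_upwards [nhdsWithin_le_nhds this] with ρ h _
        linarith
      · exact Filter.Eventually.of_forall fun ρ h => absurd h hj
    obtain ⟨ρ, h, hpos⟩ := ((Filter.eventually_all.2 this).and self_mem_nhdsWithin).exists
    exact ⟨ρ, hpos, h⟩
  obtain ⟨ρ, hpos, hρ⟩ := hρ
  refine ⟨ρ, hpos, fun y s h1 h2 j => ?_⟩
  simp only [Metric.mem_closedBall]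
  constructor
  · intro h
    by_contra! hj
    have := hρ j hj
    have := dist_triangle (z j) y x
    rw [dist_comm y x] at this
    linarith
  · intro h
    have := dist_triangle (z j) x y
    linarith

/-- The room left by `exists_pos_closedBall_trace` allows a dense centre and a rational radius. This
turns unions over all balls into countable ones, for measurability. -/
theorem exists_dense_rat_closedBall_trace {X α : Type*} [PseudoMetricSpace X] [Nonempty X]
    [TopologicalSpace.SeparableSpace X] [Finite α] (z : α → X) (x : X) {r : ℝ} (hr : 0 < r) :
    ∃ (k : ℕ) (q : ℚ), 0 < q ∧ ∀ j,
      (z j ∈ Metric.closedBall (TopologicalSpace.denseSeq X k) (q : ℝ) ↔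
        z j ∈ Metric.closedBall x r) := by
  obtain ⟨ρ, hρ, h⟩ := exists_pos_closedBall_trace z x r
  obtain ⟨k, hk⟩ := (TopologicalSpace.denseRange_denseSeq X).exists_dist_lt x
    (show 0 < ρ / 4 by positivity)
  obtain ⟨q, hq1, hq2⟩ := exists_rat_btwn (show r + ρ / 4 < r + ρ / 2 by linarith)
  refine ⟨k, q, ?_, h _ _ (by linarith) (by linarith)⟩
  exact_mod_cast (show (0 : ℝ) < q by linarith)

/-! ### Concentration: random signs, swaps, Chebyshev -/

/-- **Hoeffding's inequality** for Rademacher sums, in counting form. -/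
theorem card_abs_signed_sum_ge_le {ι : Type*} [Fintype ι] [DecidableEq ι] (a : ι → ℝ)
    {V t : ℝ} (hV : 0 < V) (ha : ∑ i, a i ^ 2 ≤ V) (ht : 0 ≤ t) :
    ((Finset.univ.filter fun A : ι → Bool => t ≤ |∑ i, if A i then -a i else a i|).card : ℝ) ≤
      2 ^ Fintype.card ι * (2 * Real.exp (-(t ^ 2 / (2 * V)))) := by
  have hmgf : ∀ l : ℝ, ∑ A : ι → Bool, Real.exp (l * ∑ i, if A i then -a i else a i) ≤
      2 ^ Fintype.card ι * Real.exp (l ^ 2 * V / 2) := by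
    intro l
    have h1 : ∑ A : ι → Bool, Real.exp (l * ∑ i, if A i then -a i else a i) =
        ∏ i, (2 * Real.cosh (l * a i)) := by
      have := Finset.prod_univ_sum (fun _ : ι => (Finset.univ : Finset Bool))
        (fun i e => Real.exp (l * if e then -a i else a i))
      rw [Fintype.piFinset_univ] at this
      simp_rw [Finset.mul_sum, Real.exp_sum]
      rw [← this]
      refine Finset.prod_congr rfl fun i _ => ?_
      rw [Real.cosh_eq]
      simp
      ring
    rw [h1, Finset.prod_mul_distrib, Finset.prod_const, Finset.card_univ]
    gcongr
    calc ∏ i, Real.cosh (l * a i) ≤ ∏ i, Real.exp ((l * a i) ^ 2 / 2) :=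
          Finset.prod_le_prod (fun i _ => (Real.cosh_pos _).le)
            fun i _ => Real.cosh_le_exp_half_sq _
      _ = Real.exp (l ^ 2 * (∑ i, a i ^ 2) / 2) := by
          rw [← Real.exp_sum, Finset.mul_sum, Finset.sum_div]
          simp_rw [mul_pow]
      _ ≤ _ := by gcongr
  -- This `l` minimises the Chernoff exponent `l ^ 2 * V / 2 - l * t`.
  set l := t / V with hl
  have hl0 : 0 ≤ l := by positivity
  have hle : ((Finset.univ.filter fun A : ι → Bool =>
      t ≤ |∑ i, if A i then -a i else a i|).card : ℝ) * Real.exp (l * t) ≤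
      ∑ A : ι → Bool, (Real.exp (l * ∑ i, if A i then -a i else a i) +
        Real.exp (-l * ∑ i, if A i then -a i else a i)) := by
    rw [← nsmul_eq_mul, ← Finset.sum_const]
    refine (Finset.sum_le_sum fun A hA => ?_).trans (Finset.sum_le_sum_of_subset_of_nonneg
      (Finset.filter_subset _ _) fun A _ _ => by positivity)
    rcases le_abs.1 (Finset.mem_filter.1 hA).2 with h | h
    · exact (Real.exp_le_exp.2 (by gcongr)).trans (le_add_of_nonneg_right (Real.exp_pos _).le)
    · refine (Real.exp_le_exp.2 ?_).trans (le_add_of_nonneg_left (Real.exp_pos _).le)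
      rw [neg_mul, ← mul_neg]; gcongr
  rw [Finset.sum_add_distrib] at hle
  have h3 := hle.trans (add_le_add (hmgf l) (hmgf (-l)))
  have e1 : l * t = t ^ 2 / V := by rw [hl]; ring
  have e2 : l ^ 2 * V / 2 = t ^ 2 / (2 * V) := by rw [hl]; field_simp
  have e3 : (-l) ^ 2 * V / 2 = t ^ 2 / (2 * V) := by rw [neg_sq, e2]
  rw [e1, e2, e3] at h3
  have e4 : Real.exp (t ^ 2 / V) = Real.exp (t ^ 2 / (2 * V)) * Real.exp (t ^ 2 / (2 * V)) := by
    rw [← Real.exp_add]; congr 1; field_simp; ring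
  rw [e4, ← mul_assoc] at h3
  have hpos := Real.exp_pos (t ^ 2 / (2 * V))
  rw [Real.exp_neg, ← mul_assoc, ← div_eq_mul_inv, le_div_iff₀ hpos]
  refine le_of_mul_le_mul_right (h3.trans (le_of_eq ?_)) hpos
  ring

/-- Symmetrisation: a measurable event on `n` pairs, of which every orbit under coordinatewise
swaps contains at most a proportion `K`, has probability at most `K`. -/
theorem measure_pi_prod_le_of_card_swap_le {E ι : Type*} [MeasurableSpace E] [Fintype ι]
    [DecidableEq ι] (p : Measure E) [IsProbabilityMeasure p] {D : Set (ι → E × E)}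
    (hD : MeasurableSet D) {K : ℝ}
    (h : ∀ ω : ι → E × E, (Nat.card {A : ι → Bool // (fun i => if A i then (ω i).swap else ω i) ∈ D} : ℝ) ≤
      2 ^ Fintype.card ι * K) :
    (Measure.pi fun _ : ι => p.prod p) D ≤ ENNReal.ofReal K := by
  classical
  set P := Measure.pi fun _ : ι => p.prod p
  let σ : (ι → Bool) → (ι → E × E) → ι → E × E := fun A ω i => if A i then (ω i).swap else ω i
  have hσ : ∀ A, MeasurePreserving (σ A) P P := by
    intro A
    have := measurePreserving_pi (fun _ : ι => p.prod p) (fun _ : ι => p.prod p)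
      (f := fun i w => if A i then w.swap else w) (fun i => by
        by_cases hA : A i
        · simpa [hA] using Measure.measurePreserving_swap (μ := p) (ν := p)
        · simpa [hA] using! MeasurePreserving.id (p.prod p))
    exact this
  -- Each swap preserves `P`, so the probability of `D` is the mean over orbits of the proportion
  -- lying in `D`.
  have hsum : ∑ A : ι → Bool, P (σ A ⁻¹' D) = 2 ^ Fintype.card ι * P D := by
    simp_rw [fun A => (hσ A).measure_preimage hD.nullMeasurableSet]
    simp
  have hle : ∑ A : ι → Bool, P (σ A ⁻¹' D) ≤ ENNReal.ofReal (2 ^ Fintype.card ι * K) := by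
    have : ∀ A, P (σ A ⁻¹' D) = ∫⁻ ω, (σ A ⁻¹' D).indicator 1 ω ∂P := fun A =>
      (lintegral_indicator_one ((hσ A).measurable hD)).symm
    simp_rw [this]
    rw [← lintegral_finsetSum _ fun A _ =>
      measurable_one.indicator ((hσ A).measurable hD)]
    calc _ ≤ ∫⁻ _, ENNReal.ofReal (2 ^ Fintype.card ι * K) ∂P := by
          refine lintegral_mono fun ω => ?_
          have hc := ENNReal.ofReal_le_ofReal (h ω)
          rw [ENNReal.ofReal_natCast] at hc
          refine le_trans (le_of_eq ?_) hc
          rw [Nat.card_eq_fintype_card, Fintype.card_subtype, Finset.card_filter]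
          push_cast
          refine Finset.sum_congr rfl fun A _ => ?_
          simp [Set.indicator_apply, σ]
      _ = _ := by simp
  rw [hsum, ENNReal.ofReal_mul (by positivity), ENNReal.ofReal_pow (by norm_num),
    ENNReal.ofReal_ofNat] at hle
  exact (ENNReal.mul_le_mul_iff_right (by simp) (by simp)).1 hle

/-- Chebyshev's inequality for the number of sample points in a set. -/
theorem measure_pi_abs_count_sub_ge_le {E ι : Type*} [MeasurableSpace E] [Fintype ι]
    (p : Measure E) [IsProbabilityMeasure p] {B : Set E} (hB : MeasurableSet B) {c : ℝ}
    (hc : 0 < c) (hc2 : 2 * (Fintype.card ι * p.real B) ≤ c ^ 2) :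
    (Measure.pi fun _ : ι => p)
      {S | c ≤ |∑ i, B.indicator 1 (S i) - Fintype.card ι * p.real B|} ≤ 2⁻¹ := by
  set P := Measure.pi fun _ : ι => p
  have hm : Measurable (B.indicator (1 : E → ℝ)) := measurable_one.indicator hB
  have hL : MemLp (B.indicator (1 : E → ℝ)) 2 p :=
    (memLp_const (1 : ℝ)).indicator hB
  have hL' : ∀ i : ι, MemLp (fun S : ι → E => B.indicator (1 : E → ℝ) (S i)) 2 P := fun i =>
    hL.comp_measurePreserving (measurePreserving_eval (fun _ : ι => p) i)
  have hvar := ProbabilityTheory.variance_sum_pi (μ := fun _ : ι => p)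
    (X := fun _ => B.indicator (1 : E → ℝ)) (fun _ => hL)
  have hmean : ∫ S, (∑ i, fun S : ι → E => B.indicator (1 : E → ℝ) (S i)) S ∂P =
      Fintype.card ι * p.real B := by
    simp_rw [Finset.sum_apply]
    rw [integral_finsetSum _ fun i _ => (hL' i).integrable (by norm_num)]
    have : ∀ i : ι, ∫ S : ι → E, B.indicator (1 : E → ℝ) (S i) ∂P = p.real B := by
      intro i
      rw [← integral_indicator_one hB]
      exact integral_comp_eval (μ := fun _ : ι => p) hm.aestronglyMeasurable
    simp [this]
  have hcheb := ProbabilityTheory.meas_ge_le_variance_div_sq (μ := P)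
    (X := ∑ i, fun S : ι → E => B.indicator (1 : E → ℝ) (S i))
    (by exact memLp_finsetSum' _ fun i _ => hL' i) hc
  rw [hmean, hvar] at hcheb
  simp_rw [Finset.sum_apply] at hcheb
  refine hcheb.trans ?_
  have h1 : ProbabilityTheory.variance (B.indicator (1 : E → ℝ)) p ≤ p.real B := by
    refine (ProbabilityTheory.variance_le_expectation_sq hm.aestronglyMeasurable).trans ?_
    rw [← integral_indicator_one hB]
    refine le_of_eq (integral_congr_ae (Filter.Eventually.of_forall fun x => ?_))
    by_cases hx : x ∈ B <;> simp [hx]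
  rw [Finset.sum_const, Finset.card_univ, nsmul_eq_mul]
  have h2 : (Fintype.card ι * ProbabilityTheory.variance (B.indicator (1 : E → ℝ)) p) / c ^ 2 ≤
      2⁻¹ := by
    rw [div_le_iff₀ (by positivity)]
    have : (Fintype.card ι : ℝ) * ProbabilityTheory.variance (B.indicator (1 : E → ℝ)) p ≤
      Fintype.card ι * p.real B := by gcongr
    linarith
  refine (ENNReal.ofReal_le_ofReal h2).trans ?_
  rw [ENNReal.ofReal_inv_of_pos (by norm_num), ENNReal.ofReal_ofNat]

/-! ### Discrepancy between two samples -/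

/-- The pairs of samples for which some closed ball of positive radius holds at least `b` points
in total, while the two counts differ by at least the fraction `γ` of their sum. -/
def ballDiscrepancyEvent (E ι : Type*) [PseudoMetricSpace E] [Fintype ι] (b γ : ℝ) :
    Set (ι → E × E) :=
  {ω | ∃ (x : E) (r : ℝ), 0 < r ∧
    b ≤ ∑ i, (Metric.closedBall x r).indicator 1 (ω i).1 +
      ∑ i, (Metric.closedBall x r).indicator 1 (ω i).2 ∧
    γ * (∑ i, (Metric.closedBall x r).indicator 1 (ω i).1 +
      ∑ i, (Metric.closedBall x r).indicator 1 (ω i).2) ≤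
      |∑ i, (Metric.closedBall x r).indicator 1 (ω i).1 -
        ∑ i, (Metric.closedBall x r).indicator 1 (ω i).2|}

theorem measurableSet_ballDiscrepancyEvent {E ι : Type*} [PseudoMetricSpace E] [Nonempty E]
    [TopologicalSpace.SeparableSpace E] [MeasurableSpace E] [OpensMeasurableSpace E] [Fintype ι]
    (b γ : ℝ) : MeasurableSet (ballDiscrepancyEvent E ι b γ) := by
  have hcount : ∀ (x : E) (r : ℝ),
      Measurable (fun ω : ι → E × E => ∑ i, (Metric.closedBall x r).indicator (1 : E → ℝ) (ω i).1) ∧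
      Measurable (fun ω : ι → E × E =>
        ∑ i, (Metric.closedBall x r).indicator (1 : E → ℝ) (ω i).2) := by
    intro x r
    have hm : Measurable ((Metric.closedBall x r).indicator (1 : E → ℝ)) :=
      measurable_one.indicator Metric.isClosed_closedBall.measurableSet
    exact ⟨Finset.measurable_sum _ fun i _ => hm.comp (measurable_fst.comp (measurable_pi_apply i)),
      Finset.measurable_sum _ fun i _ => hm.comp (measurable_snd.comp (measurable_pi_apply i))⟩
  have heq : ballDiscrepancyEvent E ι b γ = ⋃ (k : ℕ) (q : ℚ) (_ : 0 < q),
      {ω : ι → E × E |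
        b ≤ ∑ i, (Metric.closedBall (TopologicalSpace.denseSeq E k) (q : ℝ)).indicator 1 (ω i).1 +
          ∑ i, (Metric.closedBall (TopologicalSpace.denseSeq E k) (q : ℝ)).indicator 1 (ω i).2 ∧
        γ * (∑ i, (Metric.closedBall (TopologicalSpace.denseSeq E k) (q : ℝ)).indicator 1 (ω i).1 +
          ∑ i, (Metric.closedBall (TopologicalSpace.denseSeq E k) (q : ℝ)).indicator 1 (ω i).2) ≤
        |∑ i, (Metric.closedBall (TopologicalSpace.denseSeq E k) (q : ℝ)).indicator 1 (ω i).1 -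
          ∑ i, (Metric.closedBall (TopologicalSpace.denseSeq E k) (q : ℝ)).indicator 1 (ω i).2|} := by
    ext ω
    simp only [Set.mem_iUnion, exists_prop]
    constructor
    · rintro ⟨x, r, hr, h⟩
      obtain ⟨k, q, hq, hz⟩ := exists_dense_rat_closedBall_trace
        (Sum.elim (fun i => (ω i).1) fun i => (ω i).2) x hr
      refine ⟨k, q, hq, ?_⟩
      have hind : ∀ y : E, (y ∈ Metric.closedBall (TopologicalSpace.denseSeq E k) (q : ℝ) ↔
          y ∈ Metric.closedBall x r) →
          (Metric.closedBall (TopologicalSpace.denseSeq E k) (q : ℝ)).indicator (1 : E → ℝ) y =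
            (Metric.closedBall x r).indicator 1 y := by
        intro y hy
        classical
        simp only [Set.indicator_apply, hy]
      have h1 := fun i => hind _ (hz (Sum.inl i))
      have h2 := fun i => hind _ (hz (Sum.inr i))
      simp only [Sum.elim_inl, Sum.elim_inr] at h1 h2
      simpa only [Set.mem_ofPred_eq, h1, h2] using h
    · rintro ⟨k, q, hq, h⟩
      exact ⟨_, q, by exact_mod_cast hq, h⟩
  rw [heq]
  refine MeasurableSet.iUnion fun k => MeasurableSet.iUnion fun q => MeasurableSet.iUnion fun _ => ?_
  obtain ⟨h1, h2⟩ := hcount (TopologicalSpace.denseSeq E k) q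
  exact (measurableSet_le measurable_const (h1.add h2)).inter
    (measurableSet_le ((h1.add h2).const_mul γ) (h1.sub h2).abs)

/-- Along a swap orbit the `2n` points stay fixed and only signs of count differences change: a
union bound over traces times Hoeffding for each trace. -/
theorem measure_ballDiscrepancyEvent_le {d : ℕ} {ι : Type*} [Fintype ι]
    (p : Measure (EuclideanSpace ℝ (Fin d))) [IsProbabilityMeasure p] {b γ : ℝ} (hb : 0 < b)
    (hγ : 0 ≤ γ) :
    (Measure.pi fun _ : ι => p.prod p) (ballDiscrepancyEvent (EuclideanSpace ℝ (Fin d)) ι b γ) ≤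
      ENNReal.ofReal ((2 * Fintype.card ι + 1) ^ (d + 2) * (2 * Real.exp (-(γ ^ 2 * b / 2)))) := by
  classical
  refine measure_pi_prod_le_of_card_swap_le p (measurableSet_ballDiscrepancyEvent b γ) fun ω => ?_
  let z : ι ⊕ ι → EuclideanSpace ℝ (Fin d) := Sum.elim (fun i => (ω i).1) fun i => (ω i).2
  let 𝒜 : Finset (Finset (ι ⊕ ι)) := Finset.univ.filter fun t =>
    ∃ x r, 0 < r ∧ ∀ j, j ∈ t ↔ z j ∈ Metric.closedBall x r
  have h𝒜 : (𝒜.card : ℝ) ≤ (2 * Fintype.card ι + 1) ^ (d + 2) := by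
    have := card_closedBall_traces_le z 𝒜 fun t ht => (Finset.mem_filter.1 ht).2
    rw [Fintype.card_sum, ← two_mul] at this
    exact_mod_cast this
  let u : Finset (ι ⊕ ι) → ι → ℝ := fun t i => if Sum.inl i ∈ t then 1 else 0
  let v : Finset (ι ⊕ ι) → ι → ℝ := fun t i => if Sum.inr i ∈ t then 1 else 0
  let T : Finset (ι ⊕ ι) → ℝ := fun t => ∑ i, (u t i + v t i)
  let F : Finset (ι ⊕ ι) → Finset (ι → Bool) := fun t => Finset.univ.filter fun A =>
    b ≤ T t ∧ γ * T t ≤ |∑ i, if A i then -(u t i - v t i) else (u t i - v t i)|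
  have hF : ∀ t, ((F t).card : ℝ) ≤
      2 ^ Fintype.card ι * (2 * Real.exp (-(γ ^ 2 * b / 2))) := by
    intro t
    by_cases hT : b ≤ T t
    · have hTpos : 0 < T t := hb.trans_le hT
      -- Taking the total count as variance proxy turns the exponent into `γ ^ 2 * T t / 2`, which
      -- is at least `γ ^ 2 * b / 2`.
      have hsq : ∑ i, (u t i - v t i) ^ 2 ≤ T t := by
        refine Finset.sum_le_sum fun i _ => ?_
        simp only [u, v]
        split_ifs <;> norm_num
      have := card_abs_signed_sum_ge_le (fun i => u t i - v t i) hTpos hsq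
        (mul_nonneg hγ hTpos.le)
      simp only [F, hT, true_and]
      refine this.trans ?_
      have e : (γ * T t) ^ 2 / (2 * T t) = γ ^ 2 * T t / 2 := by field_simp
      rw [e]
      gcongr
    · simp only [F, hT, false_and, Finset.filter_false, Finset.card_empty, Nat.cast_zero]
      positivity
  have hsub : (Finset.univ.filter fun A : ι → Bool =>
      (fun i => if A i then (ω i).swap else ω i) ∈
        ballDiscrepancyEvent (EuclideanSpace ℝ (Fin d)) ι b γ) ⊆ 𝒜.biUnion F := by
    intro A hA
    obtain ⟨x, r, hr, h1, h2⟩ := (Finset.mem_filter.1 hA).2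
    let t : Finset (ι ⊕ ι) := Finset.univ.filter fun j => z j ∈ Metric.closedBall x r
    have hu : ∀ i, u t i = (Metric.closedBall x r).indicator 1 (ω i).1 := by
      intro i; simp [u, t, z, Set.indicator_apply]
    have hv : ∀ i, v t i = (Metric.closedBall x r).indicator 1 (ω i).2 := by
      intro i; simp [v, t, z, Set.indicator_apply]
    rw [← Finset.sum_add_distrib, ← Finset.sum_sub_distrib] at h2
    rw [← Finset.sum_add_distrib] at h1
    have e1 : ∑ i, ((Metric.closedBall x r).indicator (1 : EuclideanSpace ℝ (Fin d) → ℝ)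
        (if A i then (ω i).swap else ω i).1 +
        (Metric.closedBall x r).indicator 1 (if A i then (ω i).swap else ω i).2) = T t := by
      refine Finset.sum_congr rfl fun i _ => ?_
      rw [hu, hv]
      split_ifs
      · rw [add_comm]; rfl
      · rfl
    have e2 : ∑ i, ((Metric.closedBall x r).indicator (1 : EuclideanSpace ℝ (Fin d) → ℝ)
        (if A i then (ω i).swap else ω i).1 -
        (Metric.closedBall x r).indicator 1 (if A i then (ω i).swap else ω i).2) =
        ∑ i, if A i then -(u t i - v t i) else (u t i - v t i) := by
      refine Finset.sum_congr rfl fun i _ => ?_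
      rw [hu, hv]
      split_ifs
      · rw [neg_sub]; rfl
      · rfl
    rw [e1] at h1
    rw [e1, e2] at h2
    refine Finset.mem_biUnion.2 ⟨t, Finset.mem_filter.2 ⟨Finset.mem_univ _, x, r, hr, fun j => ?_⟩,
      Finset.mem_filter.2 ⟨Finset.mem_univ _, h1, h2⟩⟩
    simp [t]
  rw [Nat.card_eq_fintype_card, Fintype.card_subtype]
  calc _ ≤ ((𝒜.biUnion F).card : ℝ) := by exact_mod_cast Finset.card_le_card hsub
    _ ≤ ∑ t ∈ 𝒜, ((F t).card : ℝ) := by exact_mod_cast Finset.card_biUnion_le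
    _ ≤ 𝒜.card • (2 ^ Fintype.card ι * (2 * Real.exp (-(γ ^ 2 * b / 2)))) :=
      Finset.sum_le_card_nsmul _ _ _ fun t _ => hF t
    _ ≤ _ := by
      rw [nsmul_eq_mul, ← mul_assoc, mul_comm (𝒜.card : ℝ), mul_assoc]
      gcongr

/-! ### Relative deviations via a ghost sample -/

/-- The samples for which the mass of some closed ball of positive radius and its number of sample
points, when it matters for the threshold `b`, do not agree up to the factor `1 + η`. -/
def ballDeviationEvent {d : ℕ} (p : Measure (EuclideanSpace ℝ (Fin d))) (n : ℕ) (b η : ℝ) :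
    Set (Fin n → EuclideanSpace ℝ (Fin d)) :=
  {S | ∃ x r, 0 < r ∧
    (b ≤ ballCount S x r ∧ (1 + η) * (n * p.real (Metric.closedBall x r)) < ballCount S x r ∨
      (1 + η) * max (ballCount S x r : ℝ) b < n * p.real (Metric.closedBall x r))}

theorem ballCount_eq_sum_indicator {d n : ℕ} (S : Fin n → EuclideanSpace ℝ (Fin d))
    (x : EuclideanSpace ℝ (Fin d)) (r : ℝ) :
    (ballCount S x r : ℝ) = ∑ i, (Metric.closedBall x r).indicator 1 (S i) := by
  classical
  rw [ballCount, Nat.card_eq_fintype_card, Fintype.card_subtype, Finset.card_filter]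
  push_cast
  exact Finset.sum_congr rfl fun i _ => by simp [Set.indicator_apply]

/-- If the first of two counts deviates from the mean `μ` and the second one does not, then the
counts differ. -/
theorem discrepancy_of_deviation {X Y μ b η : ℝ} (hη : 0 < η) (hη1 : η ≤ 1) (hb : 0 < b)
    (hX : 0 ≤ X) (hY : 0 ≤ Y)
    (h : (b ≤ X ∧ (1 + η) * μ < X ∧ |Y - μ| < η / 8 * X) ∨
      ((1 + η) * max X b < μ ∧ |Y - μ| < η / 8 * μ)) :
    b ≤ X + Y ∧ 3 * η / 16 * (X + Y) ≤ |X - Y| := by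
  rcases h with ⟨h1, h2, h3⟩ | ⟨h1, h2⟩
  -- As `1 / (1 + η) ≤ 1 - η / 2` for `η ≤ 1`, a ghost error of `η / 8` leaves a gap of `3 * η / 8`
  -- times the larger count; the sum is at most twice that count, whence `3 * η / 16`.
  · rw [abs_lt] at h3
    have h4 : Y ≤ X - 3 * η / 8 * X := by
      have : μ ≤ X - η / 2 * X := by
        refine le_of_mul_le_mul_left (a := 1 + η) ?_ (by linarith)
        have : 0 ≤ X * η * (1 - η) := by
          have : 0 ≤ 1 - η := by linarith
          positivity
        nlinarith
      linarith
    refine ⟨by linarith, le_trans ?_ (le_abs_self _)⟩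
    nlinarith
  · rw [abs_lt] at h2
    have hμ : 0 < μ := lt_of_le_of_lt (by positivity) h1
    have hmX := le_max_left X b
    have hmb := le_max_right X b
    have hm : max X b ≤ Y - 3 * η / 8 * Y := by
      set m := max X b
      have : m ≤ μ - η / 2 * μ := by
        refine le_of_mul_le_mul_left (a := 1 + η) ?_ (by linarith)
        have : 0 ≤ μ * η * (1 - η) := by
          have : 0 ≤ 1 - η := by linarith
          positivity
        nlinarith
      have h5 : (1 - η / 8) * μ ≤ Y := by linarith
      have h6 : (1 - η / 2) * μ ≤ (1 - 3 * η / 8) * ((1 - η / 8) * μ) := by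
        have : 0 ≤ η ^ 2 * μ := by positivity
        nlinarith
      have h7 : (1 - 3 * η / 8) * ((1 - η / 8) * μ) ≤ (1 - 3 * η / 8) * Y := by
        apply mul_le_mul_of_nonneg_left h5; linarith
      linarith
    have : 0 ≤ η * Y := by positivity
    refine ⟨by linarith, le_trans ?_ (neg_le_abs _)⟩
    nlinarith

/-- **Relative deviation bound** of Vapnik-Chervonenkis type for closed Euclidean balls. -/
theorem measure_ballDeviationEvent_le {d n : ℕ} (p : Measure (EuclideanSpace ℝ (Fin d)))
    [IsProbabilityMeasure p] {b η : ℝ} (hη : 0 < η) (hη1 : η ≤ 1) (hb : 128 ≤ b * η ^ 2) :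
    (Measure.pi fun _ : Fin n => p) (ballDeviationEvent p n b η) ≤
      ENNReal.ofReal (4 * (2 * n + 1) ^ (d + 2) * Real.exp (-((3 * η / 16) ^ 2 * b / 2))) := by
  set P := Measure.pi fun _ : Fin n => p
  have hb0 : 0 < b := by
    by_contra! h
    have : b * η ^ 2 ≤ 0 := mul_nonpos_of_nonpos_of_nonneg h (by positivity)
    linarith
  set D := ballDiscrepancyEvent (EuclideanSpace ℝ (Fin d)) (Fin n) b (3 * η / 16)
  have hD : MeasurableSet D := measurableSet_ballDiscrepancyEvent _ _
  let e := MeasurableEquiv.arrowProdEquivProdArrow (EuclideanSpace ℝ (Fin d))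
    (EuclideanSpace ℝ (Fin d)) (Fin n)
  have he : MeasurePreserving e (Measure.pi fun _ : Fin n => p.prod p) (P.prod P) :=
    measurePreserving_arrowProdEquivProdArrow _ _ _ (fun _ => p) (fun _ => p)
  have hD' : MeasurableSet (e.symm ⁻¹' D) := e.symm.measurable hD
  -- For a fixed bad `S`, one deviating ball is chosen; Chebyshev for this single ball keeps the
  -- ghost count near its mean with probability at least 1/2.
  have hghost : ballDeviationEvent p n b η ⊆
      {S | (2⁻¹ : ENNReal) ≤ P (Prod.mk S ⁻¹' (e.symm ⁻¹' D))} := by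
    rintro S ⟨x, r, hr, hS⟩
    set B := Metric.closedBall x r
    have hB : MeasurableSet B := Metric.isClosed_closedBall.measurableSet
    set X : ℝ := (ballCount S x r : ℝ)
    set μ : ℝ := n * p.real B with hμdef
    have hμ0 : 0 ≤ μ := by positivity
    have hX0 : 0 ≤ X := Nat.cast_nonneg _
    obtain ⟨c, hc, hc2, hcS⟩ : ∃ c, 0 < c ∧ 2 * μ ≤ c ^ 2 ∧
        ((b ≤ X ∧ (1 + η) * μ < X ∧ c = η / 8 * X) ∨
          ((1 + η) * max X b < μ ∧ c = η / 8 * μ)) := by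
      -- This is Chebyshev's requirement at tolerance `η / 8`, and the source of the constant `128 =
      -- 2 * 8 ^ 2`.
      have hbig : ∀ y, b ≤ y → 2 * y ≤ (η / 8 * y) ^ 2 := by
        intro y hy
        have h1 : 128 ≤ y * η ^ 2 := hb.trans (by gcongr)
        have hy0 : 0 ≤ y := hb0.le.trans hy
        nlinarith
      rcases hS with ⟨h1, h2⟩ | h
      · refine ⟨η / 8 * X, by have := hb0.trans_le h1; positivity, ?_, Or.inl ⟨h1, h2, rfl⟩⟩
        refine le_trans ?_ (hbig X h1)
        nlinarith
      · have h1 : b ≤ μ := by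
          have := le_max_right X b
          nlinarith
        exact ⟨η / 8 * μ, by have := hb0.trans_le h1; positivity, hbig μ h1, Or.inr ⟨h, rfl⟩⟩
    have hcheb := measure_pi_abs_count_sub_ge_le (ι := Fin n) p hB hc
      (by rw [Fintype.card_fin]; exact hc2)
    rw [Fintype.card_fin] at hcheb
    set G := {S' : Fin n → EuclideanSpace ℝ (Fin d) |
      c ≤ |∑ i, B.indicator 1 (S' i) - n * p.real B|} with hG
    have hGm : MeasurableSet G := by
      have hm : Measurable (B.indicator (1 : EuclideanSpace ℝ (Fin d) → ℝ)) :=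
        measurable_one.indicator hB
      exact measurableSet_le measurable_const ((Finset.measurable_sum _ fun i _ =>
        hm.comp (measurable_pi_apply i)).sub measurable_const).abs
    have hcompl : (2⁻¹ : ENNReal) ≤ P Gᶜ := by
      rw [prob_compl_eq_one_sub hGm]
      calc (2⁻¹ : ENNReal) = 1 - 2⁻¹ := ENNReal.one_sub_inv_two.symm
        _ ≤ _ := tsub_le_tsub_left hcheb _
    refine hcompl.trans (measure_mono fun S' hS' => ?_)
    simp only [hG, Set.mem_compl_iff, Set.mem_ofPred_eq, not_le] at hS'
    refine ⟨x, r, hr, ?_⟩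
    have hXs : X = ∑ i, B.indicator 1 (S i) := ballCount_eq_sum_indicator S x r
    have hfst : ∀ i, (e.symm (S, S') i).1 = S i := fun i => rfl
    have hsnd : ∀ i, (e.symm (S, S') i).2 = S' i := fun i => rfl
    simp only [hfst, hsnd]
    rw [← hXs]
    refine discrepancy_of_deviation (μ := μ) hη hη1 hb0 hX0
      (Finset.sum_nonneg fun i _ => Set.indicator_nonneg (fun _ _ => zero_le_one) _) ?_
    rcases hcS with ⟨h1, h2, h3⟩ | ⟨h1, h2⟩
    · exact Or.inl ⟨h1, h2, h3 ▸ hS'⟩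
    · exact Or.inr ⟨h1, h2 ▸ hS'⟩
  have hmarkov := mul_meas_ge_le_lintegral (μ := P) (measurable_measure_prodMk_left hD'
    (ν := P)) (2⁻¹ : ENNReal)
  rw [← Measure.prod_apply hD', (he.symm e).measure_preimage hD.nullMeasurableSet] at hmarkov
  have hbound := measure_ballDiscrepancyEvent_le (ι := Fin n) p hb0
    (show 0 ≤ 3 * η / 16 by positivity)
  rw [Fintype.card_fin] at hbound
  calc P (ballDeviationEvent p n b η) ≤
        P {S | (2⁻¹ : ENNReal) ≤ P (Prod.mk S ⁻¹' (e.symm ⁻¹' D))} := measure_mono hghost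
    _ = 2 * (2⁻¹ * P {S | (2⁻¹ : ENNReal) ≤ P (Prod.mk S ⁻¹' (e.symm ⁻¹' D))}) := by
      rw [← mul_assoc, ENNReal.mul_inv_cancel (by simp) (by simp), one_mul]
    _ ≤ 2 * ENNReal.ofReal ((2 * n + 1) ^ (d + 2) *
        (2 * Real.exp (-((3 * η / 16) ^ 2 * b / 2)))) := by gcongr; exact hmarkov.trans hbound
    _ = _ := by
      rw [← ENNReal.ofReal_ofNat, ← ENNReal.ofReal_mul (by norm_num)]
      congr 1; ring

/-! ### From ball counts to the estimator -/

theorem ballCount_mono {d n : ℕ} (S : Fin n → EuclideanSpace ℝ (Fin d))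
    (x : EuclideanSpace ℝ (Fin d)) {s r : ℝ} (h : s ≤ r) : ballCount S x s ≤ ballCount S x r :=
  Nat.card_le_card_of_injective (fun i => ⟨i.1, Metric.closedBall_subset_closedBall h i.2⟩)
    fun _ _ hij => Subtype.ext (congrArg (fun i => i.1) hij)

theorem ballCount_lt_of_lt_rStar {d n b : ℕ} {S : Fin n → EuclideanSpace ℝ (Fin d)}
    {x : EuclideanSpace ℝ (Fin d)} {s : ℝ} (hs : 0 < s) (h : s < rStar b S x) :
    ballCount S x s < b := by
  by_contra! hb
  exact notMem_of_lt_csInf h ⟨0, fun _ ht => ht.1.le⟩ ⟨hs, hb⟩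

/-- The count of a closed ball is right-continuous in the radius, so the infimum `rStar` already
reaches the threshold, even when it is `0`. The hypothesis `b ≤ n` makes the defining set nonempty.
-/
theorem le_ballCount_of_rStar_le {d n b : ℕ} (hbn : b ≤ n) {S : Fin n → EuclideanSpace ℝ (Fin d)}
    {x : EuclideanSpace ℝ (Fin d)} {r : ℝ} (h : rStar b S x ≤ r) : b ≤ ballCount S x r := by
  obtain ⟨ρ, hρ, htr⟩ := exists_pos_closedBall_trace S x r
  have hne : {s : ℝ | 0 < s ∧ b ≤ ballCount S x s}.Nonempty := by
    refine ⟨1 + ∑ i, dist (S i) x, by positivity, hbn.trans (le_of_eq ?_)⟩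
    have : ∀ i, S i ∈ Metric.closedBall x (1 + ∑ i, dist (S i) x) := fun i => by
      have := Finset.single_le_sum (f := fun i => dist (S i) x) (fun i _ => dist_nonneg)
        (Finset.mem_univ i)
      rw [Metric.mem_closedBall]
      linarith
    simp [ballCount, this]
  obtain ⟨s, ⟨-, hs⟩, hsr⟩ := exists_lt_of_csInf_lt hne (show rStar b S x < r + ρ by linarith)
  have heq : ballCount S x (r + ρ) = ballCount S x r := by
    unfold ballCount
    exact Nat.card_congr (Equiv.subtypeEquivRight (htr x (r + ρ) (by simp [hρ.le]) (by simp)))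
  exact heq ▸ hs.trans (ballCount_mono S x hsr.le)

theorem isAccurate_of_le {d n k b : ℕ} {p : Measure (EuclideanSpace ℝ (Fin d))} {ε : ℝ}
    {x : EuclideanSpace ℝ (Fin d)} {r : ℝ} {S : Fin n → EuclideanSpace ℝ (Fin d)} (hε : 0 < ε)
    (hp : 0 < p.real (Metric.closedBall x r))
    (h1 : Est k b x r S ≤ (1 + ε / 2) * p.real (Metric.closedBall x r))
    (h2 : p.real (Metric.closedBall x r) ≤ (1 + ε / 2) * Est k b x r S) :
    IsAccurate p k b ε x r S := by
  refine ⟨?_, (div_le_iff₀ hp).2 h1⟩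
  rwa [inv_le_iff_one_le_mul₀ (by positivity), div_mul_eq_mul_div,
    one_le_div hp, mul_comm]

/-- Continuity from below bounds the open ball, and the null sphere adds nothing. With tied points
the count at `rStar` may exceed `b`; this bounds the mass through smaller radii instead. -/
theorem measureReal_closedBall_le_of_sphere_null {X : Type*} [PseudoMetricSpace X]
    [MeasurableSpace X] (p : Measure X) [IsFiniteMeasure p] {x : X} {R a : ℝ} (hR : 0 < R)
    (hsph : p (Metric.sphere x R) = 0)
    (h : ∀ s, 0 < s → s < R → p.real (Metric.closedBall x s) ≤ a) :
    p.real (Metric.closedBall x R) ≤ a := by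
  obtain ⟨u, humono, hu, hlim⟩ := exists_seq_strictMono_tendsto' hR
  have hU : ⋃ j, Metric.closedBall x (u j) = Metric.ball x R := by
    ext y
    simp only [Set.mem_iUnion, Metric.mem_closedBall, Metric.mem_ball]
    constructor
    · rintro ⟨j, hj⟩
      exact hj.trans_lt (hu j).2
    · intro hy
      obtain ⟨j, hj⟩ := (hlim.eventually (eventually_gt_nhds hy)).exists
      exact ⟨j, hj.le⟩
  have ht : Filter.Tendsto (fun j => p (Metric.closedBall x (u j))) Filter.atTop
      (nhds (p (Metric.ball x R))) := by
    rw [← hU]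
    exact tendsto_measure_iUnion_atTop fun i j hij =>
      Metric.closedBall_subset_closedBall (humono.monotone hij)
  have ht' : Filter.Tendsto (fun j => p.real (Metric.closedBall x (u j))) Filter.atTop
      (nhds (p.real (Metric.ball x R))) :=
    (ENNReal.tendsto_toReal (measure_ne_top p _)).comp ht
  have hball := le_of_tendsto' ht' fun j => h _ (hu j).1 (hu j).2
  refine le_trans ?_ hball
  rw [← Metric.ball_union_sphere]
  refine (measureReal_union_le _ _).trans ?_
  simp [Measure.real, hsph]

/-- Off the deviation event, the estimator is accurate. -/
theorem mem_estAccurateEvent_of_notMem_ballDeviationEvent {d n k b : ℕ}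
    {p : Measure (EuclideanSpace ℝ (Fin d))} [IsProbabilityMeasure p] {ε pε : ℝ} (hε : 0 < ε)
    (hreg : IsRegularityConstant p k ε pε) (hb : 0 < b) (hbn : 2 * (b : ℝ) ≤ n * pε)
    {S : Fin n → EuclideanSpace ℝ (Fin d)}
    (hS : S ∉ ballDeviationEvent p n b (min ε 1 / 8)) : S ∈ estAccurateEvent p k b n ε := by
  obtain ⟨hpε, hpε1, hreg⟩ := hreg
  have hbR : (0 : ℝ) < b := by exact_mod_cast hb
  have hn0 : (0 : ℝ) ≤ n := Nat.cast_nonneg n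
  have hbn' : b ≤ n := by
    have : (b : ℝ) ≤ n := by nlinarith
    exact_mod_cast this
  have hn : (0 : ℝ) < n := hbR.trans_le (by exact_mod_cast hbn')
  have hm0 : 0 < min ε 1 := lt_min hε one_pos
  have hm1 : min ε 1 ≤ 1 := min_le_right _ _
  have hmε : min ε 1 ≤ ε := min_le_left _ _
  -- With `η ≤ ε / 8` and `η ≤ 1 / 8`, `(1 + ε / 3) * (1 + η) ≤ 1 + ε / 3 + ε / 8 + ε / 24 = 1 + ε /
  -- 2`.
  set η := min ε 1 / 8 with hη
  have hη0 : 0 < η := by positivity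
  have hdev : ∀ x r, 0 < r → (b ≤ ballCount S x r →
      (ballCount S x r : ℝ) ≤ (1 + η) * (n * p.real (Metric.closedBall x r))) ∧
      n * p.real (Metric.closedBall x r) ≤ (1 + η) * max (ballCount S x r : ℝ) b := by
    intro x r hr
    constructor
    · intro h
      by_contra! hlt
      exact hS ⟨x, r, hr, Or.inl ⟨by exact_mod_cast h, hlt⟩⟩
    · by_contra! hlt
      exact hS ⟨x, r, hr, Or.inr hlt⟩
  have hcount : ∀ x r, 0 < r → rStar b S x ≤ r → IsAccurate p k b ε x r S := by
    intro x r hr hle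
    have hX := le_ballCount_of_rStar_le hbn' hle
    have hXR : (b : ℝ) ≤ ballCount S x r := by exact_mod_cast hX
    obtain ⟨h1, h2⟩ := hdev x r hr
    replace h1 := h1 hX
    rw [max_eq_left hXR] at h2
    have hq : 0 < p.real (Metric.closedBall x r) := by
      by_contra! h
      have : (1 + η) * (n * p.real (Metric.closedBall x r)) ≤ 0 :=
        mul_nonpos_of_nonneg_of_nonpos (by positivity) (mul_nonpos_of_nonneg_of_nonpos hn0 h)
      linarith
    have hEst : Est k b x r S = ballCount S x r / n := by rw [Est, if_neg hle.not_gt]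
    have hηε : 1 + η ≤ 1 + ε / 2 := by linarith
    refine isAccurate_of_le hε hq ?_ ?_
    · rw [hEst, div_le_iff₀ hn]
      refine h1.trans (le_trans (mul_le_mul_of_nonneg_right hηε (by positivity)) (le_of_eq ?_))
      ring
    · rw [hEst, ← mul_div_assoc, le_div_iff₀ hn, mul_comm]
      exact h2.trans (mul_le_mul_of_nonneg_right hηε (by positivity))
  refine ⟨fun x hx r hr hcase => ?_, hcount⟩
  rcases le_or_gt (rStar b S x) r with hle | hlt
  · exact hcount x r hr hle
  set R := rStar b S x with hRdef
  have hR : 0 < R := hr.trans hlt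
  have hXR : b ≤ ballCount S x R := le_ballCount_of_rStar_le hbn' le_rfl
  have hlow : (b : ℝ) ≤ (1 + η) * (n * p.real (Metric.closedBall x R)) :=
    le_trans (by exact_mod_cast hXR) ((hdev x R hR).1 hXR)
  have hup : n * p.real (Metric.closedBall x R) ≤ (1 + η) * b := by
    rcases hcase with heq | hsph
    · have := (hdev x R hR).2
      rwa [heq, max_self] at this
    · rw [mul_comm, ← le_div_iff₀ hn]
      refine measureReal_closedBall_le_of_sphere_null p hR hsph fun s hs hsR => ?_
      rw [le_div_iff₀ hn, mul_comm]
      have hlt' : (ballCount S x s : ℝ) ≤ b := by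
        exact_mod_cast (ballCount_lt_of_lt_rStar hs hsR).le
      have := (hdev x s hs).2
      rwa [max_eq_right hlt'] at this
  -- The factor 2 in `hbn` absorbs `1 + η`; regularity now applies between `r` and `R`.
  have hRp : p.real (Metric.closedBall x R) ≤ pε := by
    refine le_of_mul_le_mul_left (a := (n : ℝ)) ?_ hn
    refine hup.trans (le_trans ?_ hbn)
    gcongr
    linarith
  have hq : 0 < p.real (Metric.closedBall x r) :=
    ENNReal.toReal_pos ((Measure.mem_support_iff_forall x).1 hx _
      (Metric.closedBall_mem_nhds x hr)).ne' (measure_ne_top p _)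
  obtain ⟨h1, h2⟩ := hreg x hx r R hr hlt hRp
  have hrk : 0 < r ^ k := by positivity
  have hRk : 0 < R ^ k := by positivity
  set q := p.real (Metric.closedBall x r)
  set Q := p.real (Metric.closedBall x R)
  have hθ : R ^ k / r ^ k = (r ^ k / R ^ k)⁻¹ := (inv_div _ _).symm
  have hEst : Est k b x r S = b / n * (r ^ k / R ^ k) := by
    rw [Est, if_pos hlt, mul_div_mul_comm]
  rw [hθ] at h1 h2
  set θ := r ^ k / R ^ k
  have hθ0 : 0 < θ := by positivity
  have h1' : q ≤ (1 + ε / 3) * (Q * θ) := by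
    rw [← mul_inv, inv_le_iff_one_le_mul₀ (by positivity), div_mul_eq_mul_div, one_le_div hq] at h1
    linarith
  have h2' : Q * θ ≤ (1 + ε / 3) * q := by
    rw [div_le_iff₀ hq] at h2
    calc Q * θ ≤ (1 + ε / 3) * θ⁻¹ * q * θ := by gcongr
      _ = (1 + ε / 3) * q := by field_simp
  have hprod : (1 + ε / 3) * (1 + η) ≤ 1 + ε / 2 := by
    have : ε * η ≤ ε * (1 / 8) := by gcongr; linarith
    nlinarith
  have hlow' : (b : ℝ) / n ≤ (1 + η) * Q := by
    rw [div_le_iff₀ hn]; linarith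
  have hup' : Q ≤ (1 + η) * (b / n) := by
    rw [← mul_div_assoc, le_div_iff₀ hn]; linarith
  refine isAccurate_of_le hε hq ?_ ?_
  · rw [hEst]
    calc (b : ℝ) / n * θ ≤ (1 + η) * Q * θ := by gcongr
      _ = (1 + η) * (Q * θ) := by ring
      _ ≤ (1 + η) * ((1 + ε / 3) * q) := by gcongr
      _ = (1 + ε / 3) * (1 + η) * q := by ring
      _ ≤ _ := by gcongr
  · rw [hEst]
    calc q ≤ (1 + ε / 3) * (Q * θ) := h1'
      _ ≤ (1 + ε / 3) * ((1 + η) * (b / n) * θ) := by gcongr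
      _ = (1 + ε / 3) * (1 + η) * (b / n * θ) := by ring
      _ ≤ _ := by gcongr

/-! ### Constants and the final estimate -/

/-- The failure probability of the relative deviation bound at the given threshold. -/
theorem deviation_bound_le {d n : ℕ} (hd : 1 ≤ d) (hn : 3 ≤ n) {δ x : ℝ} (hδ : 0 < δ)
    (hδ1 : δ ≤ 1) (hx : 18 * (d * Real.log (n / δ)) ≤ x) :
    4 * (2 * (n : ℝ) + 1) ^ (d + 2) * Real.exp (-x) ≤ δ := by
  have hnR : (3 : ℝ) ≤ n := by exact_mod_cast hn
  have hn0 : (0 : ℝ) < n := by linarith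
  have hexp : Real.exp (-x) ≤ δ * (1 / n) ^ (11 * d) := by
    calc Real.exp (-x) ≤ Real.exp ((18 * d : ℕ) * -Real.log (n / δ)) := by
          refine Real.exp_le_exp.2 ?_
          push_cast
          linarith
      _ = (δ / n) ^ (18 * d) := by
          rw [Real.exp_nat_mul, ← Real.log_inv, Real.exp_log (by positivity), inv_div]
      _ = δ ^ (18 * d) * (1 / n) ^ (18 * d) := by rw [← mul_pow]; congr 1; ring
      _ ≤ δ * (1 / n) ^ (11 * d) := by
          have h1 : δ ^ (18 * d) ≤ δ := pow_le_of_le_one hδ.le hδ1 (by omega)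
          have h2 : (1 / (n : ℝ)) ^ (18 * d) ≤ (1 / n) ^ (11 * d) :=
            pow_le_pow_of_le_one (by positivity) (by rw [div_le_one hn0]; linarith) (by omega)
          gcongr
  have hpoly : 4 * (2 * (n : ℝ) + 1) ^ (d + 2) ≤ (n : ℝ) ^ (11 * d) := by
    calc 4 * (2 * (n : ℝ) + 1) ^ (d + 2) ≤ (n : ℝ) ^ 2 * ((n : ℝ) ^ 3) ^ (3 * d) := by
          have h1 : (4 : ℝ) ≤ (n : ℝ) ^ 2 := by nlinarith
          have h2 : 2 * (n : ℝ) + 1 ≤ (n : ℝ) ^ 3 := by nlinarith [mul_self_nonneg ((n : ℝ) - 3)]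
          have h3 : (2 * (n : ℝ) + 1) ^ (d + 2) ≤ (2 * (n : ℝ) + 1) ^ (3 * d) :=
            pow_le_pow_right₀ (by linarith) (by omega)
          have h4 : (2 * (n : ℝ) + 1) ^ (3 * d) ≤ ((n : ℝ) ^ 3) ^ (3 * d) := by gcongr
          exact mul_le_mul h1 (h3.trans h4) (by positivity) (by positivity)
      _ = (n : ℝ) ^ (2 + 9 * d) := by rw [← pow_mul, ← pow_add]; congr 1; ring
      _ ≤ _ := pow_le_pow_right₀ (by linarith) (by omega)
  calc _ ≤ (n : ℝ) ^ (11 * d) * (δ * (1 / n) ^ (11 * d)) := by gcongr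
    _ = δ * ((n : ℝ) * (1 / n)) ^ (11 * d) := by rw [mul_pow]; ring
    _ = δ := by rw [mul_one_div_cancel hn0.ne', one_pow, mul_one]

/-- Inverting `n / log (n / δ)`. -/
theorem mul_log_div_le_of_le {t a δ L n : ℝ} (ht : 1 ≤ 2 * t) (ha : 0 < a) (hδ : 0 < δ)
    (hn0 : 0 < n) (hL : 1 / 2 ≤ L) (haL : Real.log (a / δ) ≤ 2 * L)
    (hn : 2 * t * (2 * Real.log (2 * t) + 2) * (a * L) ≤ n) : t * a * Real.log (n / δ) ≤ n := by
  have ht0 : 0 < t := by linarith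
  have hlog : 0 ≤ Real.log (2 * t) := Real.log_nonneg ht
  -- The first logarithm is at most its argument and costs `n / 2`; the other two are bounded by
  -- multiples of `L` and cost the other half.
  have hsplit : Real.log (n / δ) = Real.log (n / (2 * t * a)) +
      (Real.log (2 * t) + Real.log (a / δ)) := by
    rw [← Real.log_mul (by positivity) (by positivity), ← Real.log_mul (by positivity)
      (by positivity)]
    congr 1
    field_simp
  have h1 : Real.log (n / (2 * t * a)) ≤ n / (2 * t * a) := Real.log_le_self (by positivity)
  have h2 : t * a * (n / (2 * t * a)) = n / 2 := by field_simp
  have h3 : Real.log (2 * t) + Real.log (a / δ) ≤ (2 * Real.log (2 * t) + 2) * L := by nlinarith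
  have hta : 0 < t * a := by positivity
  rw [hsplit, mul_add]
  have h4 := mul_le_mul_of_nonneg_left h1 hta.le
  have h5 := mul_le_mul_of_nonneg_left h3 hta.le
  rw [h2] at h4
  linarith

/-- The bound on the measure of the complement is a bound on the outer measure: the accuracy event
contains a measurable event of probability at least `1 - δ`. -/
theorem mainTheorem3 :
    ∃ c₀ : ℝ, 0 < c₀ ∧ ∀ c : ℝ, c₀ ≤ c → ∃ C : ℝ, 0 < C ∧
      ∀ (d : ℕ), 1 ≤ d →
      ∀ (p : Measure (EuclideanSpace ℝ (Fin d))) [IsProbabilityMeasure p] (k : ℕ),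
      IsKRegular p k →
      ∀ (ε δ pε : ℝ), 0 < ε → 0 < δ → δ < 1 → IsRegularityConstant p k ε pε →
      ∀ n : ℕ,
        C * ((d : ℝ) * Real.log (2 * (d : ℝ) / (δ * min ε 1 * pε)) / ((min ε 1) ^ 2 * pε))
            ≤ (n : ℝ) →
        (Measure.pi fun _ : Fin n => p)
            (estAccurateEvent p k (countThreshold c d n ε δ) n ε)ᶜ ≤ ENNReal.ofReal δ := by
  -- At `η = m / 8` the deviation exponent is `9 * b * m ^ 2 / 32768`; with `b * m ^ 2 ≥ 65536 * d *
  -- l` it reaches the `18 * d * l` needed in `deviation_bound_le`.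
  refine ⟨65536, by norm_num, fun c hc => ?_⟩
  have hc0 : 0 < c := by linarith
  have hlogc : 0 ≤ Real.log (2 * (4 * c)) := Real.log_nonneg (by linarith)
  -- This is `mul_log_div_le_of_le` at `t = 4 * c`: one factor 2 absorbs the rounding in `b`, the
  -- other gives `2 * b ≤ n * pε`.
  refine ⟨2 * (4 * c) * (2 * Real.log (2 * (4 * c)) + 2), by positivity, ?_⟩
  intro d hd p _ k _ ε δ pε hε hδ hδ1 hreg n hn
  obtain ⟨hpε, hpε1, -⟩ := id hreg
  have hdR : (1 : ℝ) ≤ d := by exact_mod_cast hd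
  set m := min ε 1 with hm
  have hm0 : 0 < m := lt_min hε one_pos
  have hm1 : m ≤ 1 := min_le_right _ _
  set L := Real.log (2 * (d : ℝ) / (δ * m * pε)) with hL
  have hden : 0 < δ * m * pε := by positivity
  have hδm : δ * m * pε ≤ 1 := mul_le_one₀ (mul_le_one₀ hδ1.le hm0.le hm1) hpε.le hpε1
  have hLhalf : 1 / 2 ≤ L := by
    have h1 : Real.log 2 ≤ L := by
      refine Real.log_le_log two_pos ?_
      rw [le_div_iff₀ hden]
      nlinarith
    have := Real.log_two_gt_d9
    linarith
  set a := (d : ℝ) / (m ^ 2 * pε) with ha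
  have ha0 : 0 < a := by positivity
  have hden' : m ^ 2 * pε ≤ 1 := mul_le_one₀ (pow_le_one₀ hm0.le hm1) hpε.le hpε1
  have ha1 : 1 ≤ a := by
    rw [ha, le_div_iff₀ (by positivity)]
    linarith
  have hnC : 2 * (4 * c) * (2 * Real.log (2 * (4 * c)) + 2) * (a * L) ≤ n := by
    refine le_trans (le_of_eq ?_) hn
    rw [ha]; ring
  have hn3R : (3 : ℝ) ≤ n := by
    have h1 : 1 / 2 ≤ a * L := by nlinarith
    have h2 : 2 * (4 * c) * 2 * (1 / 2) ≤
        2 * (4 * c) * (2 * Real.log (2 * (4 * c)) + 2) * (a * L) := by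
      gcongr
      linarith
    linarith
  have hn3 : 3 ≤ n := by exact_mod_cast hn3R
  -- The square of the argument of `L` dominates `a / δ`.
  have haL : Real.log (a / δ) ≤ 2 * L := by
    rw [hL, ← Nat.cast_ofNat, ← Real.log_pow]
    refine Real.log_le_log (by positivity) ?_
    rw [ha, div_div, div_pow, div_le_div_iff₀ (by positivity) (by positivity)]
    have h1 : δ * pε ≤ 1 := mul_le_one₀ hδ1.le hpε.le hpε1
    have h2 : (δ * m * pε) ^ 2 = δ * pε * (m ^ 2 * pε * δ) := by ring
    rw [h2, ← mul_assoc]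
    gcongr
    push_cast
    nlinarith
  have hlog := mul_log_div_le_of_le (by linarith) ha0 hδ (by linarith) hLhalf haL hnC
  set l := Real.log ((n : ℝ) / δ) with hl
  have hl1 : 1 ≤ l := by
    rw [hl, Real.le_log_iff_exp_le (by positivity), le_div_iff₀ hδ]
    have := Real.exp_one_lt_d9
    nlinarith [Real.exp_pos 1]
  set b := countThreshold c d n ε δ with hbdef
  have hb1 : c * (d * l / m ^ 2) ≤ b := Nat.le_ceil _
  have hb2 : (b : ℝ) < c * (d * l / m ^ 2) + 1 := Nat.ceil_lt_add_one (by positivity)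
  have hdl : 1 ≤ d * l := one_le_mul_of_one_le_of_one_le hdR hl1
  have hbm : c * (d * l) ≤ b * m ^ 2 := by
    have := mul_le_mul_of_nonneg_right hb1 (sq_nonneg m)
    refine le_trans (le_of_eq ?_) this
    field_simp
  have hbpos : 0 < b := by
    have : (0 : ℝ) < b := lt_of_lt_of_le (by positivity) hb1
    exact_mod_cast this
  have hbn : 2 * (b : ℝ) ≤ n * pε := by
    have h1 : 1 ≤ c * (d * l / m ^ 2) := by
      have : 1 ≤ d * l / m ^ 2 := by
        rw [le_div_iff₀ (by positivity), one_mul]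
        exact (pow_le_one₀ hm0.le hm1).trans hdl
      nlinarith
    have h2 : 4 * (c * (d * l / m ^ 2)) = 4 * c * a * l * pε := by
      rw [ha]; field_simp
    have h3 := mul_le_mul_of_nonneg_right hlog hpε.le
    linarith
  have hcdl : 65536 * (d * l) ≤ b * m ^ 2 := le_trans (by gcongr) hbm
  calc (Measure.pi fun _ : Fin n => p) (estAccurateEvent p k b n ε)ᶜ ≤
        (Measure.pi fun _ : Fin n => p) (ballDeviationEvent p n b (m / 8)) := by
        refine measure_mono fun S hS => ?_
        by_contra h
        exact hS (mem_estAccurateEvent_of_notMem_ballDeviationEvent hε hreg hbpos hbn h)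
    _ ≤ _ := measure_ballDeviationEvent_le p (by positivity) (by linarith) (by nlinarith)
    _ ≤ ENNReal.ofReal δ := by
        refine ENNReal.ofReal_le_ofReal (deviation_bound_le hd hn3 hδ hδ1.le ?_)
        nlinarith
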